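/- Let $\Sigma$ be a fixed finite set of size $k=|\Sigma|>3$. An $n$-quasigroup on $\Sigma$ is an operation $f:\Sigma^n\to\Sigma$ such that in the equality $z_0=f(z_1,\ldots,z_n)$ any $n$ of the elements $z_0,z_1,\ldots,z_n$ uniquely specify the remaining one. Let $|Q(n,k)|$ be the number of different $n$-quasigroups $\Sigma^n\to\Sigma$. Then the following bounds hold for every $n$. (a) If $k$ is even, then $|Q(n,k)|\geq 2^{(k/2)^n}$. (b) If $k$ is divisible by $3$, then $|Q(n,k)|\geq 2^{n(k/3)^n}$. (c) If $k=5$, then $|Q(n,k)|\geq 2^{3^{n/3-c}}$, where the constant $c<0.072$ depends only on $n\bmod 3$. (d) In all other cases (that is, if $k$ is divisible neither by $2$ nor by $3$ and $k\neq 5$), $|Q(n,k)|\geq 2^{1.5\lfloor k/3\rfloor^n}$. In particular, the number grows at least double-exponentially in $n$: for every $k>3$ there is $c(k)>0$ such that $|Q(n,k)|\geq 2^{2^{c(k)n}}$ for every $n$. -/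

import Mathlib

/-- `f : S ^ n → S` is an `n`-ary quasigroup: in the equality `z₀ = f (z₁, …, zₙ)`, for every
position `i` the values of `z₀` and of all `z_j` with `j ≠ i` determine `z_i` uniquely
(it exists and is unique). That `z₁, …, zₙ` determine `z₀` holds because `f` is a function. -/
def IsNQuasigroup {n : ℕ} {S : Type*} (f : (Fin n → S) → S) : Prop :=
  ∀ (i : Fin n) (x : Fin n → S), Function.Bijective fun a : S => f (Function.update x i a)

/-- The set of all `n`-ary quasigroup operations `S ^ n → S` on the fixed set `S`. -/
def nQuasigroups (n : ℕ) (S : Type*) : Set ((Fin n → S) → S) :=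
  {f | IsNQuasigroup f}

/-! Two constructions give all the bounds. If `k = |B| * |T|` with `T` an abelian group, use the sum
on `T` and choose, for each of the `|T| ^ n` tuples over `T`, an arbitrary `n`-quasigroup on `B`
(`ncard_pow_le_ncard_nQuasigroups_prod`). For `B = ZMod 2` there are at least 2 choices each time,
for `B = ZMod 3` at least `2 ^ n`.

The other `k` need switching. Fix an involution `σ` of `S` and join two cells of `f` that lie on a
common line and have values exchanged by `σ`. Applying `σ` to the values on any union of connected
components leaves a quasigroup, so `N` components whose values `σ` moves give `2 ^ N` of them. A
labelling constant on components bounds their number from below. Under `op (f, g)` labels multiply: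
from `N₁` and `N₂` labels per value one gets `r * (N₁ * N₂) + 1` (`HasSwitchLabels.comp`). For `k =
5` a loop with a subloop of order 2 has `r = 1`; adding three arguments turns `N` into `3 * N + 1`.
For `k = 2 * t + 1` with `t ≥ 3`, doubling an idempotent quasigroup of order `t` gives `r = t - 1`
and `t` orbits moved by `σ`, hence exponent `t * (t - 1) ^ (n - 1)`. -/

open Function

/-! ### Counting, relabelling and arities 0 and 1 -/

section Basic

variable {S S' : Type*} {n : ℕ}

theorem isNQuasigroup_of_injective [Finite S] {f : (Fin n → S) → S}
    (h : ∀ i x a b, f (update x i a) = f (update x i b) → a = b) : IsNQuasigroup f := by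
  intro i x
  exact Finite.injective_iff_bijective.1 fun a b hab => h i x a b hab

theorem IsNQuasigroup.eq_of_update {f : (Fin n → S) → S} (h : IsNQuasigroup f) {i : Fin n}
    {x : Fin n → S} {a b : S} (hab : f (update x i a) = f (update x i b)) : a = b :=
  (h i x).1 hab

theorem le_ncard_nQuasigroups [Finite S] {α : Type*} [Finite α] (F : α → (Fin n → S) → S)
    (hF : Injective F) (hq : ∀ a, IsNQuasigroup (F a)) :
    Nat.card α ≤ (nQuasigroups n S).ncard := by
  rw [← Set.ncard_univ α, ← Set.ncard_image_of_injective Set.univ hF]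
  refine Set.ncard_le_ncard ?_ (Set.toFinite _)
  rintro _ ⟨a, -, rfl⟩
  exact hq a

theorem IsNQuasigroup.congr {f : (Fin n → S) → S} (h : IsNQuasigroup f) (e : S ≃ S') :
    IsNQuasigroup fun x : Fin n → S' => e (f (e.symm ∘ x)) := by
  intro i x
  have : (fun a : S' => e (f (e.symm ∘ update x i a))) =
      e ∘ (fun a => f (update (e.symm ∘ x) i a)) ∘ e.symm := by
    funext a
    simp only [comp_apply, comp_update]
  rw [this]
  exact e.bijective.comp ((h i _).comp e.symm.bijective)

theorem ncard_nQuasigroups_le_of_equiv [Finite S'] (e : S ≃ S') (n : ℕ) :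
    (nQuasigroups n S).ncard ≤ (nQuasigroups n S').ncard := by
  have : Finite S := Finite.of_equiv _ e.symm
  refine le_ncard_nQuasigroups (α := nQuasigroups n S)
    (fun f x => e (f.1 (e.symm ∘ x))) ?_ (fun f => IsNQuasigroup.congr f.2 e)
  intro f g hfg
  ext x
  have := congrFun hfg (e ∘ x)
  simpa [← comp_assoc] using this

theorem card_le_ncard_nQuasigroups_zero [Finite S] :
    Nat.card S ≤ (nQuasigroups 0 S).ncard :=
  le_ncard_nQuasigroups (fun a _ => a) (fun _ _ h => congrFun h Fin.elim0)
    fun _ i => i.elim0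

theorem factorial_card_le_ncard_nQuasigroups_one [Finite S] :
    (Nat.card S).factorial ≤ (nQuasigroups 1 S).ncard := by
  classical
  rw [← Nat.card_perm]
  refine le_ncard_nQuasigroups (fun (e : Equiv.Perm S) x => e (x 0)) ?_ ?_
  · intro e e' h
    ext s
    exact congrFun h fun _ => s
  · intro e i x
    obtain rfl : i = 0 := Subsingleton.elim _ _
    simpa using e.bijective

end Basic

/-! ### Composite orders: independent operations over a group -/

section Wreath

variable {B T : Type*} {n : ℕ}

/-- Combine a family of operations on `B`, indexed by `T ^ n`, with the sum on `T`. -/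
def wreathOp [AddCommGroup T] (h : (Fin n → T) → (Fin n → B) → B) (x : Fin n → B × T) : B × T :=
  (h (fun j => (x j).2) fun j => (x j).1, ∑ j, (x j).2)

theorem isNQuasigroup_sum [AddCommGroup T] [Finite T] :
    IsNQuasigroup fun x : Fin n → T => ∑ j, x j := by
  refine isNQuasigroup_of_injective fun i x a b hab => ?_
  simpa [Finset.sum_update_of_mem] using hab

/-- The sum fixes the `T`-coordinate of the unknown argument; after that a single operation `h t` is
in play and fixes its `B`-coordinate. -/
theorem isNQuasigroup_wreathOp [AddCommGroup T] [Finite T] [Finite B]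
    {h : (Fin n → T) → (Fin n → B) → B} (hh : ∀ t, IsNQuasigroup (h t)) :
    IsNQuasigroup (wreathOp h) := by
  have hfst (x : Fin n → B × T) (i c) :
      (fun j => (update x i c j).1) = update (fun j => (x j).1) i c.1 := by
    funext j
    exact apply_update (fun _ => Prod.fst) x i c j
  have hsnd (x : Fin n → B × T) (i c) :
      (fun j => (update x i c j).2) = update (fun j => (x j).2) i c.2 := by
    funext j
    exact apply_update (fun _ => Prod.snd) x i c j
  refine isNQuasigroup_of_injective fun i x a b hab => ?_
  have h2 : a.2 = b.2 := by
    refine (isNQuasigroup_sum (T := T) (n := n)).eq_of_update (i := i) (x := fun j => (x j).2) ?_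
    rw [← hsnd, ← hsnd]
    exact congrArg Prod.snd hab
  have h1 := congrArg Prod.fst hab
  simp only [wreathOp, hfst, hsnd, h2] at h1
  exact Prod.ext ((hh _).eq_of_update h1) h2

theorem ncard_pow_le_ncard_nQuasigroups_prod [AddCommGroup T] [Finite T] [Finite B] :
    (nQuasigroups n B).ncard ^ (Nat.card T ^ n) ≤ (nQuasigroups n (B × T)).ncard := by
  have := le_ncard_nQuasigroups (α := (Fin n → T) → nQuasigroups n B)
    (fun h => wreathOp fun t => (h t).1) ?_ fun h => isNQuasigroup_wreathOp fun t => (h t).2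
  · simpa [Nat.card_fun, Nat.card_coe_set_eq] using this
  · intro h h' heq
    funext t
    ext b
    exact congrArg Prod.fst (congrFun heq fun j => (b j, t j))

theorem two_le_ncard_nQuasigroups_zmod_two : 2 ≤ (nQuasigroups n (ZMod 2)).ncard := by
  have := le_ncard_nQuasigroups (fun (c : ZMod 2) (x : Fin n → ZMod 2) => (∑ j, x j) + c) ?_ ?_
  · simpa using this
  · intro c c' h
    simpa using congrFun h 0
  · intro c
    refine isNQuasigroup_of_injective fun i x a b hab => ?_
    exact isNQuasigroup_sum.eq_of_update (add_right_cancel hab)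

/-- Linear forms with coefficients `±1`, told apart by their values at the unit vectors. -/
theorem two_pow_le_ncard_nQuasigroups_zmod_three : 2 ^ n ≤ (nQuasigroups n (ZMod 3)).ncard := by
  have := le_ncard_nQuasigroups
    (fun (u : Fin n → (ZMod 3)ˣ) (x : Fin n → ZMod 3) => ∑ j, (u j : ZMod 3) * x j) ?_ ?_
  · have h2 : Fintype.card (ZMod 3)ˣ = 2 := by decide
    simpa [Nat.card_fun, h2] using this
  · intro u u' h
    funext i
    have := congrFun h (Pi.single i 1)
    simpa [Pi.single_apply, Units.ext_iff] using this
  · intro u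
    refine isNQuasigroup_of_injective fun i x a b hab => ?_
    have key (c : ZMod 3) : (fun j => (u j : ZMod 3) * update x i c j) =
        update (fun j => (u j : ZMod 3) * x j) i (u i * c) := by
      funext j
      exact apply_update (fun j y => (u j : ZMod 3) * y) x i c j
    simp only [congrFun (key _)] at hab
    exact (u i).isUnit.mul_left_cancel (isNQuasigroup_sum.eq_of_update hab)

end Wreath

/-! ### Switching components and their growth under composition -/

section Switching

variable {S : Type} {C M : Type} {n : ℕ}

/-- `L` is constant along the lines that join two cells whose values are exchanged by `σ`. -/
def IsSwitchLabelling (σ : S → S) (f : (Fin n → S) → S) (L : (Fin n → S) → M) : Prop :=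
  ∀ x i a, f (update x i a) = σ (f x) → L (update x i a) = L x

open Classical in
/-- Apply `σ` to the values of `f` in all cells whose label is selected by `ε`. -/
noncomputable def switchOp (σ : S → S) (f : (Fin n → S) → S) (L : (Fin n → S) → M) (ε : Set M)
    (x : Fin n → S) : S :=
  if L x ∈ ε then σ (f x) else f x

/-- Two cells of a line can collide only if exactly one is switched and their old values are
exchanged by `σ`; but such cells share a label, so both or neither are switched. -/
theorem isNQuasigroup_switchOp [Finite S] {σ : S → S} (hσ : Involutive σ) {f : (Fin n → S) → S}
    {L : (Fin n → S) → M} (hf : IsNQuasigroup f) (hL : IsSwitchLabelling σ f L) (ε : Set M) :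
    IsNQuasigroup (switchOp σ f L ε) := by
  refine isNQuasigroup_of_injective fun i x a b hab => ?_
  have key (a b) (h : f (update x i a) = σ (f (update x i b))) :
      L (update x i a) = L (update x i b) := by
    have := hL (update x i b) i a
    rw [update_idem] at this
    exact this h
  unfold switchOp at hab
  split_ifs at hab with h1 h2 h2
  · exact hf.eq_of_update (hσ.injective hab)
  · exact absurd (key _ _ hab.symm ▸ h1) h2
  · exact absurd (key _ _ hab ▸ h2) h1
  · exact hf.eq_of_update hab

/-- Each label in `I` occurs on a cell whose value `σ` moves, so the set of switched labels can be
read off the resulting operation. -/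
theorem two_pow_le_ncard_nQuasigroups [Finite S] {σ : S → S} (hσ : Involutive σ)
    {f : (Fin n → S) → S} {L : (Fin n → S) → M} (hf : IsNQuasigroup f)
    (hL : IsSwitchLabelling σ f L) (I : Finset M)
    (hI : ∀ m ∈ I, ∃ x, L x = m ∧ σ (f x) ≠ f x) :
    2 ^ I.card ≤ (nQuasigroups n S).ncard := by
  have := le_ncard_nQuasigroups (α := Set I)
    (fun ε => switchOp σ f L (Subtype.val '' ε)) ?_ fun ε => isNQuasigroup_switchOp hσ hf hL _
  · simpa [Nat.card_eq_fintype_card] using this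
  · intro ε ε' h
    ext ⟨m, hm⟩
    obtain ⟨x, rfl, hx⟩ := hI m hm
    have := congrFun h x
    simp only [switchOp] at this
    have e (δ : Set I) : (L x ∈ Subtype.val '' δ) ↔ (⟨L x, hm⟩ : I) ∈ δ := by simp [hm]
    rw [← e ε, ← e ε']
    split_ifs at this with h1 h2 h2
    · exact iff_of_true h1 h2
    · exact absurd this hx
    · exact absurd this.symm hx
    · exact iff_of_false h1 h2

/-- The involution `σ` acts compatibly with `op` at `(y, z)`: the rows `y`, `σ y` and the columns
`z`, `σ z` form a subsquare with values exchanged by `σ`. -/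
def IsGoodBlock (op : S → S → S) (σ : S → S) (y z : S) : Prop :=
  op (σ y) z = σ (op y z) ∧ op y (σ z) = σ (op y z) ∧ op (σ y) (σ z) = op y z

/-- A binary quasigroup with an involution `σ`, whose orbits are the fibres of `cls`, such that
each value in `W` occurs in at least `r` good blocks with rows and columns in `W`, and in at least
one cell outside all good blocks. -/
structure IsSwitchSystem (op : S → S → S) (σ : S → S) (cls : S → C) (W : Set S) (r : ℕ) :
    Prop where
  left_inj : ∀ y, Injective (op y)
  right_inj : ∀ z, Injective fun y => op y z
  invol : Involutive σ
  cls_map : ∀ s, cls (σ s) = cls s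
  ne_map : ∀ v ∈ W, σ v ≠ v
  good : ∀ v ∈ W, ∃ R : Finset (S × S), R.card = r ∧
    (∀ p ∈ R, p.1 ∈ W ∧ p.2 ∈ W ∧ op p.1 p.2 = v ∧ IsGoodBlock op σ p.1 p.2) ∧
    Set.InjOn (fun p : S × S => (cls p.1, cls p.2)) R
  bad : ∀ v ∈ W, ∃ y z, op y z = v ∧ ¬ IsGoodBlock op σ y z

open Classical in
/-- The set of labels on the cells with value `v`. -/
noncomputable def labelSet [Fintype S] (f : (Fin n → S) → S) (L : (Fin n → S) → M) (v : S) :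
    Finset M :=
  (Finset.univ.filter fun x => f x = v).image L

theorem mem_labelSet [Fintype S] {f : (Fin n → S) → S} {L : (Fin n → S) → M} {v : S} {m : M} :
    m ∈ labelSet f L v ↔ ∃ x, f x = v ∧ L x = m := by
  simp [labelSet]

/-- There is an `n`-ary quasigroup with a switch labelling that has at least `N` labels on each
of the values in `W`. -/
def HasSwitchLabels [Fintype S] (σ : S → S) (cls : S → C) (W : Set S) (n N : ℕ) : Prop :=
  ∃ (M : Type) (f : (Fin n → S) → S) (L : (Fin n → S) → M), IsNQuasigroup f ∧ Surjective f ∧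
    IsSwitchLabelling σ f L ∧ (∀ x y, L x = L y → cls (f x) = cls (f y)) ∧
    ∀ v ∈ W, N ≤ (labelSet f L v).card

variable {op : S → S → S} {σ : S → S} {cls : S → C} {W : Set S} {r : ℕ}

/-- With `map_right`: goodness belongs to the whole 2 by 2 block, so it does not change along a
switching edge. -/
theorem IsGoodBlock.map_left (hσ : Involutive σ) {y z : S} (h : IsGoodBlock op σ y z) :
    IsGoodBlock op σ (σ y) z := by
  obtain ⟨h1, h2, h3⟩ := h
  refine ⟨?_, ?_, ?_⟩
  · rw [hσ, h1, hσ]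
  · rw [h3, h1, hσ]
  · rw [hσ, h2, h1]

theorem IsGoodBlock.map_right (hσ : Involutive σ) {y z : S} (h : IsGoodBlock op σ y z) :
    IsGoodBlock op σ y (σ z) := by
  obtain ⟨h1, h2, h3⟩ := h
  refine ⟨?_, ?_, ?_⟩
  · rw [h3, h2, hσ]
  · rw [hσ, h2, hσ]
  · rw [hσ, h1, h2]

theorem update_comp_castAdd_castAdd {m n : ℕ} (x : Fin (m + n) → S) (i : Fin m) (a : S) :
    update x (Fin.castAdd n i) a ∘ Fin.castAdd n = update (x ∘ Fin.castAdd n) i a :=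
  update_comp_eq_of_injective _ (Fin.castAdd_injective m n) _ _

theorem update_comp_natAdd_natAdd {m n : ℕ} (x : Fin (m + n) → S) (i : Fin n) (a : S) :
    update x (Fin.natAdd m i) a ∘ Fin.natAdd m = update (x ∘ Fin.natAdd m) i a :=
  update_comp_eq_of_injective _ (Fin.natAdd_injective n m) _ _

theorem update_comp_castAdd_natAdd {m n : ℕ} (x : Fin (m + n) → S) (i : Fin m) (a : S) :
    update x (Fin.castAdd n i) a ∘ Fin.natAdd m = x ∘ Fin.natAdd m := by
  funext j
  refine update_of_ne (fun h => ?_) _ _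
  have := congrArg Fin.val h
  simp only [Fin.val_natAdd, Fin.val_castAdd] at this
  omega

theorem update_comp_natAdd_castAdd {m n : ℕ} (x : Fin (m + n) → S) (i : Fin n) (a : S) :
    update x (Fin.natAdd m i) a ∘ Fin.castAdd n = x ∘ Fin.castAdd n := by
  funext j
  refine update_of_ne (fun h => ?_) _ _
  have := congrArg Fin.val h
  simp only [Fin.val_natAdd, Fin.val_castAdd] at this
  omega

variable [Fintype S]

theorem hasSwitchLabels_one (hcls : ∀ s, cls (σ s) = cls s) :
    HasSwitchLabels σ cls W 1 1 := by
  refine ⟨C, fun x => x 0, fun x => cls (x 0), ?_, fun s => ⟨fun _ => s, rfl⟩, ?_,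
    fun _ _ h => h, ?_⟩
  · refine isNQuasigroup_of_injective fun i x a b hab => ?_
    obtain rfl : i = 0 := Subsingleton.elim _ _
    simpa using hab
  · intro x i a h
    simp only [h, hcls]
  · intro v _
    exact Finset.card_pos.2 ⟨cls v, mem_labelSet.2 ⟨fun _ => v, rfl, rfl⟩⟩

/-- In a good block, injectivity of `op` forces a switching edge of the composition to be one of `f`
or of `g`, so the pair of their labels persists. All cells outside good blocks share the label
`none` within a class, which accounts for the `+ 1`. -/
theorem HasSwitchLabels.comp (hs : IsSwitchSystem op σ cls W r) {m n N₁ N₂ : ℕ}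
    (h₁ : HasSwitchLabels σ cls W m N₁) (h₂ : HasSwitchLabels σ cls W n N₂) :
    HasSwitchLabels σ cls W (m + n) (r * (N₁ * N₂) + 1) := by
  classical
  obtain ⟨M₁, f, L₁, hf, fsurj, hL₁, hc₁, hN₁⟩ := h₁
  obtain ⟨M₂, g, L₂, hg, gsurj, hL₂, hc₂, hN₂⟩ := h₂
  set h : (Fin (m + n) → S) → S := fun x => op (f (x ∘ Fin.castAdd n)) (g (x ∘ Fin.natAdd m))
    with h_def
  set L : (Fin (m + n) → S) → C × Option (M₁ × M₂) := fun x => (cls (h x),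
    if IsGoodBlock op σ (f (x ∘ Fin.castAdd n)) (g (x ∘ Fin.natAdd m)) then
      some (L₁ (x ∘ Fin.castAdd n), L₂ (x ∘ Fin.natAdd m)) else none) with L_def
  have happ (y : Fin m → S) (z : Fin n → S) : Fin.append y z ∘ Fin.castAdd n = y ∧
      Fin.append y z ∘ Fin.natAdd m = z :=
    ⟨funext fun j => Fin.append_left y z j, funext fun j => Fin.append_right y z j⟩
  refine ⟨_, h, L, ?_, ?_, ?_, fun x y hxy => congrArg Prod.fst hxy, ?_⟩
  · refine isNQuasigroup_of_injective fun i x a b hab => ?_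
    induction i using Fin.addCases with
    | left i =>
      simp only [h_def, update_comp_castAdd_castAdd, update_comp_castAdd_natAdd] at hab
      exact hf.eq_of_update (hs.right_inj _ hab)
    | right i =>
      simp only [h_def, update_comp_natAdd_natAdd, update_comp_natAdd_castAdd] at hab
      exact hg.eq_of_update (hs.left_inj _ hab)
  · intro s
    -- Any tuple `z` would do; surjectivity of `g` merely supplies one.
    obtain ⟨z, -⟩ := gsurj s
    obtain ⟨u, hu⟩ := (Finite.injective_iff_surjective.1 (hs.right_inj (g z))) s
    obtain ⟨y, rfl⟩ := fsurj u
    refine ⟨Fin.append y z, ?_⟩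
    simp only [h_def, (happ y z).1, (happ y z).2]
    exact hu
  · intro x i a hx
    refine Prod.ext ?_ ?_
    · simp only [L_def, hx, hs.cls_map]
    induction i using Fin.addCases with
    | left i =>
      simp only [L_def, h_def, update_comp_castAdd_castAdd, update_comp_castAdd_natAdd] at hx ⊢
      set y := f (x ∘ Fin.castAdd n) with hy
      set y' := f (update (x ∘ Fin.castAdd n) i a) with hy'
      set z := g (x ∘ Fin.natAdd m)
      by_cases hgood : IsGoodBlock op σ y z
      · have e : y' = σ y := hs.right_inj z (hx.trans hgood.1.symm)
        rw [if_pos hgood, if_pos (e ▸ hgood.map_left hs.invol), hL₁ _ _ _ e]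
      · have hgood' : ¬ IsGoodBlock op σ y' z := by
          intro hg'
          have e : y = σ y' := hs.right_inj z <| by
            change op y z = op (σ y') z
            rw [hg'.1, hx, hs.invol]
          exact hgood (e ▸ hg'.map_left hs.invol)
        rw [if_neg hgood, if_neg hgood']
    | right i =>
      simp only [L_def, h_def, update_comp_natAdd_natAdd, update_comp_natAdd_castAdd] at hx ⊢
      set y := f (x ∘ Fin.castAdd n)
      set z := g (x ∘ Fin.natAdd m)
      set z' := g (update (x ∘ Fin.natAdd m) i a)
      by_cases hgood : IsGoodBlock op σ y z
      · have e : z' = σ z := hs.left_inj y (hx.trans hgood.2.1.symm)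
        rw [if_pos hgood, if_pos (e ▸ hgood.map_right hs.invol), hL₂ _ _ _ e]
      · have hgood' : ¬ IsGoodBlock op σ y z' := by
          intro hg'
          have e : z = σ z' := hs.left_inj y <| by
            rw [hg'.2.1, hx, hs.invol]
          exact hgood (e ▸ hg'.map_right hs.invol)
        rw [if_neg hgood, if_neg hgood']
  · intro v hv
    obtain ⟨R, hRc, hR, hinj⟩ := hs.good v hv
    set A : S × S → Finset (C × Option (M₁ × M₂)) := fun p =>
      (labelSet f L₁ p.1 ×ˢ labelSet g L₂ p.2).image fun q => (cls v, some q) with hA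
    have hsub : insert (cls v, none) (R.biUnion A) ⊆ labelSet h L v := by
      intro q hq
      rw [Finset.mem_insert, Finset.mem_biUnion] at hq
      rw [mem_labelSet]
      rcases hq with rfl | ⟨p, hp, hq⟩
      · obtain ⟨y, z, rfl, hbad⟩ := hs.bad v hv
        obtain ⟨y, rfl⟩ := fsurj y
        obtain ⟨z, rfl⟩ := gsurj z
        refine ⟨Fin.append y z, ?_, ?_⟩
        · simp only [h_def, (happ y z).1, (happ y z).2]
        · simp only [L_def, h_def, (happ y z).1, (happ y z).2, if_neg hbad]
      · obtain ⟨⟨a, b⟩, hab, rfl⟩ := Finset.mem_image.1 hq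
        obtain ⟨ha, hb⟩ := Finset.mem_product.1 hab
        obtain ⟨y, hy, rfl⟩ := mem_labelSet.1 ha
        obtain ⟨z, hz, rfl⟩ := mem_labelSet.1 hb
        obtain ⟨-, -, hval, hgood⟩ := hR p hp
        rw [← hy, ← hz] at hval hgood
        refine ⟨Fin.append y z, ?_, ?_⟩
        · simp only [h_def, (happ y z).1, (happ y z).2, hval]
        · simp only [L_def, h_def, (happ y z).1, (happ y z).2, if_pos hgood, hval]
    refine le_trans ?_ (Finset.card_le_card hsub)
    rw [Finset.card_insert_of_notMem (by simp [hA]), Finset.card_biUnion]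
    · gcongr
      rw [← hRc, ← smul_eq_mul]
      refine Finset.card_nsmul_le_sum _ _ _ fun p hp => ?_
      rw [hA, Finset.card_image_of_injective _ (fun q q' hqq => by simpa using hqq),
        Finset.card_product]
      exact Nat.mul_le_mul (hN₁ _ (hR p hp).1) (hN₂ _ (hR p hp).2.1)
    · intro p hp p' hp' hne
      refine Finset.disjoint_left.2 ?_
      intro q hq hq'
      obtain ⟨⟨a, b⟩, hab, rfl⟩ := Finset.mem_image.1 hq
      obtain ⟨⟨a', b'⟩, hab', heq⟩ := Finset.mem_image.1 hq'
      obtain ⟨rfl, rfl⟩ : a' = a ∧ b' = b := by simpa using heq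
      obtain ⟨ha, hb⟩ := Finset.mem_product.1 hab
      obtain ⟨ha', hb'⟩ := Finset.mem_product.1 hab'
      obtain ⟨y, hy, ey⟩ := mem_labelSet.1 ha
      obtain ⟨z, hz, ez⟩ := mem_labelSet.1 hb
      obtain ⟨y', hy', ey'⟩ := mem_labelSet.1 ha'
      obtain ⟨z', hz', ez'⟩ := mem_labelSet.1 hb'
      -- A label determines the class of the value, and distinct blocks in `R` differ in their pair
      -- of classes, so they share no label pair.
      refine hne (hinj hp hp' (Prod.ext ?_ ?_))
      · have := hc₁ y y' (ey.trans ey'.symm)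
        rwa [hy, hy'] at this
      · have := hc₂ z z' (ez.trans ez'.symm)
        rwa [hz, hz'] at this

theorem HasSwitchLabels.two_pow_le_ncard {n N : ℕ} (hσ : Involutive σ)
    (hne : ∀ v ∈ W, σ v ≠ v) (h : HasSwitchLabels σ cls W n N) (V : Finset S)
    (hV : ∀ v ∈ V, v ∈ W) (hinj : Set.InjOn cls V) :
    2 ^ (V.card * N) ≤ (nQuasigroups n S).ncard := by
  classical
  obtain ⟨M, f, L, hf, -, hL, hc, hN⟩ := h
  have := two_pow_le_ncard_nQuasigroups hσ hf hL (V.biUnion (labelSet f L)) ?_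
  · refine le_trans (Nat.pow_le_pow_right two_pos ?_) this
    rw [Finset.card_biUnion]
    · rw [← smul_eq_mul]
      exact Finset.card_nsmul_le_sum _ _ _ fun v hv => hN v (hV v hv)
    · intro v hv w hw hvw
      refine Finset.disjoint_left.2 ?_
      intro m hm hm'
      obtain ⟨x, rfl, ex⟩ := mem_labelSet.1 hm
      obtain ⟨y, rfl, ey⟩ := mem_labelSet.1 hm'
      exact hvw (hinj hv hw (hc x y (ex.trans ey.symm)))
  · intro m hm
    obtain ⟨v, hv, hm⟩ := Finset.mem_biUnion.1 hm
    obtain ⟨x, rfl, ex⟩ := mem_labelSet.1 hm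
    exact ⟨x, ex, hne _ (hV _ hv)⟩

end Switching

theorem two_rpow_le_of_two_pow_le {a N : ℕ} {x : ℝ} (hx : x ≤ a) (ha : 2 ^ a ≤ N) :
    (2 : ℝ) ^ x ≤ (N : ℝ) :=
  calc (2 : ℝ) ^ x ≤ (2 : ℝ) ^ (a : ℝ) := Real.rpow_le_rpow_of_exponent_le (by norm_num) hx
    _ = ((2 ^ a : ℕ) : ℝ) := by rw [Real.rpow_natCast]; norm_num
    _ ≤ _ := by exact_mod_cast ha

/-! ### Order 5 -/

section OrderFive

/-- A loop of order five with the subloop `{0, 1}`. -/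
def fiveOp (y z : Fin 5) : Fin 5 :=
  ![![0, 1, 2, 3, 4], ![1, 0, 3, 4, 2], ![2, 3, 4, 0, 1], ![3, 4, 1, 2, 0], ![4, 2, 0, 1, 3]] y z

theorem isSwitchSystem_fiveOp :
    IsSwitchSystem fiveOp (Equiv.swap 0 1) (fun s => if s = 1 then 0 else s) {0, 1} 1 where
  left_inj := by decide
  right_inj := by decide
  invol s := by simp
  cls_map := by decide
  ne_map := by decide
  good := by
    intro v hv
    refine ⟨{(0, v)}, rfl, ?_, by simp⟩
    simp only [Finset.mem_singleton, forall_eq]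
    refine ⟨Or.inl rfl, hv, ?_⟩
    unfold IsGoodBlock
    rcases hv with rfl | rfl <;> decide
  bad := by
    unfold IsGoodBlock
    rintro v (rfl | rfl)
    · exact ⟨2, 3, by decide⟩
    · exact ⟨2, 4, by decide⟩

/-- There is an operation on `Fin 5` with `N` independent switches of `0` and `1`. -/
abbrev HasFiveLabels : ℕ → ℕ → Prop :=
  HasSwitchLabels (Equiv.swap (0 : Fin 5) 1) (fun s => if s = 1 then 0 else s) {0, 1}

theorem HasFiveLabels.comp {m n N₁ N₂ : ℕ} (h₁ : HasFiveLabels m N₁) (h₂ : HasFiveLabels n N₂) :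
    HasFiveLabels (m + n) (N₁ * N₂ + 1) := by
  simpa using HasSwitchLabels.comp isSwitchSystem_fiveOp h₁ h₂

theorem HasFiveLabels.two_pow_le {n N : ℕ} (h : HasFiveLabels n N) :
    2 ^ N ≤ (nQuasigroups n (Fin 5)).ncard := by
  simpa using h.two_pow_le_ncard isSwitchSystem_fiveOp.invol isSwitchSystem_fiveOp.ne_map {0}
    (by simp) (by simp)

/-- Arities 2, 3, 4 carry 2, 3, 4 labels, and three more arguments at least triple the number. Arity
4 is the tight case: it needs a constant of at least `4 / 3 - log₃ 4 ≈ 0.0715`. Arity 1, with one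
label, would need a larger one. -/
theorem exists_hasFiveLabels (n : ℕ) :
    ∃ N : ℕ, HasFiveLabels (n + 2) N ∧ (3 : ℝ) ^ (((n + 2 : ℕ) : ℝ) / 3 - 14 / 195) ≤ N := by
  have h1 : HasFiveLabels 1 1 := hasSwitchLabels_one isSwitchSystem_fiveOp.cls_map
  have h2 : HasFiveLabels 2 2 := h1.comp h1
  have h3 : HasFiveLabels 3 3 := h1.comp h2
  induction n using Nat.strong_induction_on with
  | _ n ih =>
    match n with
    | 0 =>
      refine ⟨2, h2, ?_⟩
      -- The fraction `5 / 8` is a convenient bound below `log₃ 2`, since `3 ^ 5 = 243 ≤ 256 = 2 ^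
      -- 8`.
      have : (3 : ℝ) ^ (((0 + 2 : ℕ) : ℝ) / 3 - 14 / 195) ≤ 3 ^ ((5 : ℕ) / (8 : ℕ) : ℝ) :=
        Real.rpow_le_rpow_of_exponent_le (by norm_num) (by norm_num)
      refine this.trans ?_
      rw [div_eq_mul_inv, Real.rpow_mul (by norm_num), Real.rpow_natCast,
        Real.rpow_inv_le_iff_of_pos (by norm_num) (by norm_num) (by norm_num)]
      norm_num
    | 1 =>
      refine ⟨3, h3, ?_⟩
      have : (3 : ℝ) ^ (((1 + 2 : ℕ) : ℝ) / 3 - 14 / 195) ≤ 3 ^ (1 : ℝ) :=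
        Real.rpow_le_rpow_of_exponent_le (by norm_num) (by norm_num)
      simpa using this
    | 2 =>
      refine ⟨4, h1.comp h3, ?_⟩
      -- The constant `14 / 195` makes the exponent `82 / 65`, just below `log₃ 4`; what remains is
      -- `3 ^ 82 ≤ 4 ^ 65`.
      have : (3 : ℝ) ^ (((2 + 2 : ℕ) : ℝ) / 3 - 14 / 195) = 3 ^ ((82 : ℕ) / (65 : ℕ) : ℝ) := by
        norm_num
      rw [this, div_eq_mul_inv, Real.rpow_mul (by norm_num), Real.rpow_natCast,
        Real.rpow_inv_le_iff_of_pos (by norm_num) (by norm_num) (by norm_num), Real.rpow_natCast]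
      norm_num
    | n + 3 =>
      obtain ⟨N, hN, hle⟩ := ih n (by omega)
      refine ⟨N * 3 + 1, hN.comp h3, ?_⟩
      have : ((n + 3 + 2 : ℕ) : ℝ) / 3 - 14 / 195 = ((n + 2 : ℕ) : ℝ) / 3 - 14 / 195 + 1 := by
        push_cast
        ring
      rw [this, Real.rpow_add_one (by norm_num)]
      have h : ((N * 3 + 1 : ℕ) : ℝ) = N * 3 + 1 := by push_cast; rfl
      rw [h]
      linarith

theorem le_ncard_nQuasigroups_five (n : ℕ) :
    (2 : ℝ) ^ ((3 : ℝ) ^ ((n : ℝ) / 3 - 14 / 195)) ≤ ((nQuasigroups n (Fin 5)).ncard : ℝ) := by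
  match n with
  | 0 =>
    have h : (3 : ℝ) ^ (((0 : ℕ) : ℝ) / 3 - 14 / 195) ≤ 1 :=
      Real.rpow_le_one_of_one_le_of_nonpos (by norm_num) (by norm_num)
    have hc : (5 : ℕ) ≤ (nQuasigroups 0 (Fin 5)).ncard := by
      simpa using card_le_ncard_nQuasigroups_zero (S := Fin 5)
    calc _ ≤ (2 : ℝ) ^ (1 : ℝ) := Real.rpow_le_rpow_of_exponent_le (by norm_num) h
      _ ≤ (5 : ℕ) := by norm_num
      _ ≤ _ := by exact_mod_cast hc
  | 1 =>
    have h : (3 : ℝ) ^ (((1 : ℕ) : ℝ) / 3 - 14 / 195) ≤ 3 ^ (1 : ℝ) :=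
      Real.rpow_le_rpow_of_exponent_le (by norm_num) (by norm_num)
    have hc : (120 : ℕ) ≤ (nQuasigroups 1 (Fin 5)).ncard := by
      simpa [Nat.factorial] using factorial_card_le_ncard_nQuasigroups_one (S := Fin 5)
    calc _ ≤ (2 : ℝ) ^ ((3 : ℝ) ^ (1 : ℝ)) :=
          Real.rpow_le_rpow_of_exponent_le (by norm_num) h
      _ ≤ (120 : ℕ) := by norm_num
      _ ≤ _ := by exact_mod_cast hc
  | n + 2 =>
    obtain ⟨N, hN, hle⟩ := exists_hasFiveLabels n
    exact two_rpow_le_of_two_pow_le hle hN.two_pow_le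

end OrderFive

/-! ### Idempotent quasigroups of every order at least 3 -/

section Idempotent

/-- `op` is an idempotent quasigroup operation. -/
structure IsIdempotentQuasigroup {T : Type} (op : T → T → T) : Prop where
  left_inj : ∀ y, Injective (op y)
  right_inj : ∀ z, Injective fun y => op y z
  idem : ∀ y, op y y = y

theorem exists_two_mul_eq_one {t : ℕ} (ht : Odd t) : ∃ u : ZMod t, 2 * u = 1 := by
  obtain ⟨s, rfl⟩ := ht
  refine ⟨-s, ?_⟩
  have := ZMod.natCast_self (2 * s + 1)
  push_cast at this
  linear_combination -this

theorem isIdempotentQuasigroup_zmod {t : ℕ} {u : ZMod t} (hu : 2 * u = 1) :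
    IsIdempotentQuasigroup fun x y : ZMod t => (x + y) * u where
  left_inj y a b h := by linear_combination 2 * h + (b - a) * hu
  right_inj z a b h := by linear_combination 2 * h + (b - a) * hu
  idem y := by linear_combination y * hu

/-- The prolongation of the mean on `ZMod t` along the transversal `y = x + 1`. -/
def prolongOp {t : ℕ} (u : ZMod t) : Option (ZMod t) → Option (ZMod t) → Option (ZMod t)
  | none, none => none
  | some x, none => some ((2 * x + 1) * u)
  | none, some y => some ((2 * y - 1) * u)
  | some x, some y => if y = x + 1 then none else some ((x + y) * u)

/-- The cells `y = x + 1` carry each value once; these values move to the new row and column and the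
cells receive `none`. As `1 ≠ 0`, the transversal misses the diagonal, so idempotency survives. -/
theorem isIdempotentQuasigroup_prolongOp {t : ℕ} {u : ZMod t} (hu : 2 * u = 1)
    (ht : (1 : ZMod t) ≠ 0) : IsIdempotentQuasigroup (prolongOp u) where
  left_inj := by
    have key (a b : ZMod t) (h : a * u = b * u) : a = b := by
      linear_combination 2 * h + (b - a) * hu
    have key' (a b : ZMod t) (h : 2 * a = 2 * b) : a = b := by
      linear_combination u * h + (b - a) * hu
    rintro (_ | y) (_ | a) (_ | b) h <;> simp only [prolongOp] at h
    · rfl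
    · simp at h
    · simp at h
    · congr 1
      refine key' _ _ ?_
      linear_combination key _ _ (Option.some.inj h)
    · rfl
    · split_ifs at h with h1
      exact absurd (by linear_combination -key _ _ (Option.some.inj h)) h1
    · split_ifs at h with h1
      exact absurd (by linear_combination key _ _ (Option.some.inj h)) h1
    · split_ifs at h with h1 h2 h2
      · rw [h1, h2]
      · congr 1
        linear_combination key _ _ (Option.some.inj h)
  right_inj := by
    have key (a b : ZMod t) (h : a * u = b * u) : a = b := by
      linear_combination 2 * h + (b - a) * hu
    have key' (a b : ZMod t) (h : 2 * a = 2 * b) : a = b := by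
      linear_combination u * h + (b - a) * hu
    rintro (_ | z) (_ | a) (_ | b) h <;> simp only [prolongOp] at h
    · rfl
    · simp at h
    · simp at h
    · congr 1
      refine key' _ _ ?_
      linear_combination key _ _ (Option.some.inj h)
    · rfl
    · split_ifs at h with h1
      exact absurd (by linear_combination key _ _ (Option.some.inj h)) h1
    · split_ifs at h with h1
      exact absurd (by linear_combination -key _ _ (Option.some.inj h)) h1
    · split_ifs at h with h1 h2 h2
      · congr 1
        linear_combination h2 - h1
      · congr 1
        linear_combination key _ _ (Option.some.inj h)
  idem := by
    rintro (_ | y)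
    · rfl
    · have : ¬ y = y + 1 := fun h => ht (by linear_combination -h)
      simp only [prolongOp, if_neg this, Option.some.injEq]
      linear_combination y * hu

/-- For odd `t` the mean on `ZMod t` works; for even `t`, where 2 is not invertible, prolong the
mean on `ZMod (t - 1)`. -/
theorem exists_isIdempotentQuasigroup {t : ℕ} (ht : 3 ≤ t) :
    ∃ (T : Type) (_ : Fintype T) (op : T → T → T),
      Fintype.card T = t ∧ IsIdempotentQuasigroup op := by
  rcases Nat.even_or_odd t with hev | hodd
  · obtain ⟨s, rfl⟩ : ∃ s, t = s + 1 := ⟨t - 1, by omega⟩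
    have hs : Odd s := by
      rcases Nat.even_or_odd s with h | h
      · exact absurd hev (by simp [Nat.even_add_one, h])
      · exact h
    have : NeZero s := ⟨by omega⟩
    have : Fact (1 < s) := ⟨by omega⟩
    obtain ⟨u, hu⟩ := exists_two_mul_eq_one hs
    exact ⟨Option (ZMod s), inferInstance, prolongOp u, by simp,
      isIdempotentQuasigroup_prolongOp hu one_ne_zero⟩
  · have : NeZero t := ⟨by omega⟩
    obtain ⟨u, hu⟩ := exists_two_mul_eq_one hodd
    exact ⟨ZMod t, inferInstance, _, ZMod.card t, isIdempotentQuasigroup_zmod hu⟩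

end Idempotent

/-! ### Order 2t + 1 by doubling -/

section Doubling

variable {T : Type} [DecidableEq T]

/-- The loop of order `2 t + 1` that arises from an idempotent quasigroup of order `t`: each point
is doubled, and each pair of twins forms with the neutral element `none` a group of order three. -/
def doubleOp (op : T → T → T) : Option (T × Bool) → Option (T × Bool) → Option (T × Bool)
  | none, z => z
  | some p, none => some p
  | some p, some q =>
    if p.1 = q.1 then (if p.2 = q.2 then some (p.1, !p.2) else none)
    else some (op p.1 q.1, xor p.2 q.2)

/-- Exchange twins. -/
def twin : Option (T × Bool) → Option (T × Bool) :=
  Option.map fun p => (p.1, !p.2)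

/-- Off the diagonal each cell of `op` becomes a good block. Idempotency keeps the value `i` out of
the off-diagonal cells of row and column `i`, leaving room for the group of order three on `none`
and the twins over `i`. Of the `t` cells of `op` with value `i`, only the diagonal one is lost. -/
theorem isSwitchSystem_doubleOp [Fintype T] {op : T → T → T} (h : IsIdempotentQuasigroup op) :
    IsSwitchSystem (doubleOp op) twin (Option.map Prod.fst) {s | s.isSome}
      (Fintype.card T - 1) where
  left_inj := by
    have hne (i j : T) (hij : i ≠ j) : op i j ≠ i := fun e =>
      hij (h.left_inj i (by rw [e, h.idem]))
    have hinj (i j l : T) : op i j = op i l → j = l := fun e => h.left_inj i e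
    rintro (_ | ⟨i, _ | _⟩) (_ | ⟨j, _ | _⟩) (_ | ⟨l, _ | _⟩) e <;>
      simp only [doubleOp] at e ⊢ <;> grind
  right_inj := by
    have hne (i j : T) (hij : i ≠ j) : op i j ≠ j := fun e =>
      hij (h.right_inj j (by simp only [e, h.idem]))
    have hinj (i j l : T) : op j i = op l i → j = l := fun e => h.right_inj i e
    rintro (_ | ⟨i, _ | _⟩) (_ | ⟨j, _ | _⟩) (_ | ⟨l, _ | _⟩) e <;>
      simp only [doubleOp] at e ⊢ <;> grind
  invol := by
    rintro (_ | ⟨i, a⟩) <;> simp [twin]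
  cls_map := by
    rintro (_ | ⟨i, a⟩) <;> simp [twin]
  ne_map := by
    rintro (_ | ⟨i, a⟩) hv
    · simp at hv
    · simp [twin]
  good := by
    rintro (_ | ⟨i, a⟩) hv
    · simp at hv
    have hex (j : T) : ∃ l, op j l = i := Finite.injective_iff_surjective.1 (h.left_inj j) i
    choose l hl using hex
    have hjl (j : T) (hj : j ≠ i) : j ≠ l j := fun e => hj <| by
      have := hl j
      rwa [← e, h.idem] at this
    refine ⟨(Finset.univ.erase i).image fun j => (some (j, a), some (l j, false)), ?_, ?_, ?_⟩
    · rw [Finset.card_image_of_injective, Finset.card_erase_of_mem (Finset.mem_univ i),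
        Finset.card_univ]
      intro j j' e
      simpa using congrArg Prod.fst e
    · intro p hp
      obtain ⟨j, hj, rfl⟩ := Finset.mem_image.1 hp
      have := hjl j (Finset.ne_of_mem_erase hj)
      simp [doubleOp, twin, IsGoodBlock, this, hl]
    · intro p hp p' hp' e
      obtain ⟨j, hj, rfl⟩ := Finset.mem_image.1 (Finset.mem_coe.1 hp)
      obtain ⟨j', hj', rfl⟩ := Finset.mem_image.1 (Finset.mem_coe.1 hp')
      obtain ⟨rfl, -⟩ : j = j' ∧ _ := by simpa using e
      rfl
  bad := by
    rintro (_ | ⟨i, a⟩) hv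
    · simp at hv
    -- The row `none` is fixed by `twin`, so replacing it by its twin does not exchange values.
    · exact ⟨none, some (i, a), rfl, by simp [IsGoodBlock, doubleOp, twin]⟩

theorem two_pow_le_ncard_nQuasigroups_double [Fintype T] {op : T → T → T}
    (h : IsIdempotentQuasigroup op) (n : ℕ) :
    2 ^ (Fintype.card T * (Fintype.card T - 1) ^ n) ≤
      (nQuasigroups (n + 1) (Option (T × Bool))).ncard := by
  have hs := isSwitchSystem_doubleOp h
  have key : ∃ N, (Fintype.card T - 1) ^ n ≤ N ∧ HasSwitchLabels twin (Option.map Prod.fst)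
      {s : Option (T × Bool) | s.isSome} (n + 1) N := by
    induction n with
    | zero => exact ⟨1, by simp, hasSwitchLabels_one hs.cls_map⟩
    | succ n ih =>
      obtain ⟨N, hle, hN⟩ := ih
      -- One argument is added at a time, with a single label; the `+ 1` is discarded.
      refine ⟨_, ?_, hN.comp hs (hasSwitchLabels_one hs.cls_map)⟩
      rw [pow_succ', mul_one]
      exact (Nat.mul_le_mul_left _ hle).trans (Nat.le_succ _)
  obtain ⟨N, hle, hN⟩ := key
  have := hN.two_pow_le_ncard hs.invol hs.ne_map
    (Finset.univ.image fun i => some (i, false)) (by simp) ?_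
  · rw [Finset.card_image_of_injective _ fun i j e => by simpa using e, Finset.card_univ] at this
    exact (Nat.pow_le_pow_right two_pos (Nat.mul_le_mul_left _ hle)).trans this
  · intro v hv w hw e
    obtain ⟨i, -, rfl⟩ := Finset.mem_image.1 (Finset.mem_coe.1 hv)
    obtain ⟨j, -, rfl⟩ := Finset.mem_image.1 (Finset.mem_coe.1 hw)
    simpa using e

end Doubling

/-! ### The bounds for each kind of order -/

section Main

variable {S : Type*} [Finite S]

theorem two_pow_le_ncard_of_even {k : ℕ} (hcard : Nat.card S = k) (hk : 3 < k) (h2 : Even k)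
    (n : ℕ) : 2 ^ ((k / 2) ^ n) ≤ (nQuasigroups n S).ncard := by
  obtain ⟨t, rfl⟩ := h2.two_dvd
  rw [Nat.mul_div_cancel_left t two_pos]
  have : NeZero t := ⟨by omega⟩
  have e : ZMod 2 × ZMod t ≃ S := (Finite.card_eq.1 (by simp [hcard])).some
  refine le_trans ?_ (ncard_nQuasigroups_le_of_equiv e n)
  refine le_trans ?_ ncard_pow_le_ncard_nQuasigroups_prod
  rw [Nat.card_zmod]
  exact Nat.pow_le_pow_left two_le_ncard_nQuasigroups_zmod_two _

theorem two_pow_le_ncard_of_three_dvd {k : ℕ} (hcard : Nat.card S = k) (hk : 3 < k) (h3 : 3 ∣ k)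
    (n : ℕ) : 2 ^ (n * (k / 3) ^ n) ≤ (nQuasigroups n S).ncard := by
  obtain ⟨t, rfl⟩ := h3
  rw [Nat.mul_div_cancel_left t three_pos]
  have : NeZero t := ⟨by omega⟩
  have e : ZMod 3 × ZMod t ≃ S := (Finite.card_eq.1 (by simp [hcard])).some
  refine le_trans ?_ (ncard_nQuasigroups_le_of_equiv e n)
  refine le_trans ?_ ncard_pow_le_ncard_nQuasigroups_prod
  rw [Nat.card_zmod, pow_mul]
  exact Nat.pow_le_pow_left two_pow_le_ncard_nQuasigroups_zmod_three _

theorem le_ncard_of_card_eq_five (hcard : Nat.card S = 5) (n : ℕ) :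
    (2 : ℝ) ^ ((3 : ℝ) ^ ((n : ℝ) / 3 - 14 / 195)) ≤ ((nQuasigroups n S).ncard : ℝ) := by
  have e : Fin 5 ≃ S := (Finite.card_eq.1 (by simp [hcard])).some
  refine (le_ncard_nQuasigroups_five n).trans ?_
  exact_mod_cast ncard_nQuasigroups_le_of_equiv e n

theorem le_ncard_of_not_dvd {k : ℕ} (hcard : Nat.card S = k) (hk : 3 < k) (h2 : ¬ Even k)
    (h3 : ¬ 3 ∣ k) (h5 : k ≠ 5) (n : ℕ) :
    (2 : ℝ) ^ ((1.5 : ℝ) * (((k / 3 : ℕ) : ℝ) ^ n)) ≤ ((nQuasigroups n S).ncard : ℝ) := by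
  obtain ⟨t, rfl⟩ := Nat.not_even_iff_odd.1 h2
  have ht : 3 ≤ t := by omega
  cases n with
  | zero =>
    have hc : 4 ≤ (nQuasigroups 0 S).ncard :=
      le_trans (by omega) card_le_ncard_nQuasigroups_zero
    calc _ ≤ (2 : ℝ) ^ (2 : ℝ) :=
          Real.rpow_le_rpow_of_exponent_le (by norm_num) (by norm_num)
      _ ≤ (4 : ℕ) := by norm_num
      _ ≤ _ := by exact_mod_cast hc
  | succ n =>
    classical
    obtain ⟨T, _, op, hT, hop⟩ := exists_isIdempotentQuasigroup ht
    have e : Option (T × Bool) ≃ S :=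
      (Finite.card_eq.1 (by simp [hcard, hT, mul_comm])).some
    have hle := (two_pow_le_ncard_nQuasigroups_double hop n).trans
      (ncard_nQuasigroups_le_of_equiv e _)
    rw [hT] at hle
    set m := (2 * t + 1) / 3 with hm
    -- Equality `3 * m = 2 * t + 1` is excluded as 3 does not divide `k`; the next bound then uses
    -- `t ≥ 3`.
    have hm1 : 3 * m ≤ 2 * t := by omega
    have hm2 : m ≤ t - 1 := by omega
    have hexp : (1.5 : ℝ) * (m : ℝ) ^ (n + 1) ≤ ((t * (t - 1) ^ n : ℕ) : ℝ) := by
      have h1 : (3 : ℝ) * m ≤ 2 * t := by exact_mod_cast hm1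
      have h2 : (m : ℝ) ^ n ≤ ((t - 1 : ℕ) : ℝ) ^ n :=
        pow_le_pow_left₀ (by positivity) (by exact_mod_cast hm2) n
      calc (1.5 : ℝ) * (m : ℝ) ^ (n + 1) = (1.5 * m) * (m : ℝ) ^ n := by ring
        _ ≤ t * ((t - 1 : ℕ) : ℝ) ^ n :=
          mul_le_mul (by linarith) h2 (by positivity) (by positivity)
        _ = _ := by push_cast; rfl
    exact two_rpow_le_of_two_pow_le hexp hle

theorem exists_doubly_exponential_le {k : ℕ} (hcard : Nat.card S = k) (hk : 3 < k) :
    ∃ c : ℝ, 0 < c ∧ ∀ n : ℕ,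
      (2 : ℝ) ^ ((2 : ℝ) ^ (c * (n : ℝ))) ≤ ((nQuasigroups n S).ncard : ℝ) := by
  have hzero : (2 : ℝ) ^ (1 : ℝ) ≤ ((nQuasigroups 0 S).ncard : ℝ) := by
    have : 2 ≤ (nQuasigroups 0 S).ncard := le_trans (by omega) card_le_ncard_nQuasigroups_zero
    rw [Real.rpow_one]
    exact_mod_cast this
  have hpow (m n : ℕ) (hm : 2 ≤ m) : (2 : ℝ) ^ (1 * (n : ℝ)) ≤ (m : ℝ) ^ n := by
    rw [one_mul, Real.rpow_natCast]
    exact pow_le_pow_left₀ (by norm_num) (by exact_mod_cast hm) n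
  by_cases h2 : Even k
  · refine ⟨1, one_pos, fun n => ?_⟩
    refine two_rpow_le_of_two_pow_le ?_ (two_pow_le_ncard_of_even hcard hk h2 n)
    push_cast
    exact_mod_cast hpow (k / 2) n (by omega)
  by_cases h3 : 3 ∣ k
  · refine ⟨1, one_pos, fun n => ?_⟩
    rcases Nat.eq_zero_or_pos n with rfl | hn
    · simpa using hzero
    refine two_rpow_le_of_two_pow_le ?_ (two_pow_le_ncard_of_three_dvd hcard hk h3 n)
    have hk3 : 2 ≤ k / 3 := by
      obtain ⟨t, rfl⟩ := h3
      omega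
    refine (hpow (k / 3) n hk3).trans ?_
    exact_mod_cast Nat.le_mul_of_pos_left _ hn
  by_cases h5 : k = 5
  -- For `n ≥ 1` one has `n / 12 ≤ n / 3 - 14 / 195`; at `n = 0` the right side is negative, so that
  -- arity is treated apart.
  · refine ⟨1 / 12, by norm_num, fun n => ?_⟩
    rcases Nat.eq_zero_or_pos n with rfl | hn
    · simpa using hzero
    refine le_trans (Real.rpow_le_rpow_of_exponent_le (by norm_num) ?_)
      (le_ncard_of_card_eq_five (hcard.trans h5) n)
    have hn' : (1 : ℝ) ≤ n := by exact_mod_cast hn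
    calc (2 : ℝ) ^ (1 / 12 * (n : ℝ)) ≤ 2 ^ ((n : ℝ) / 3 - 14 / 195) :=
          Real.rpow_le_rpow_of_exponent_le (by norm_num) (by linarith)
      _ ≤ _ := Real.rpow_le_rpow (by norm_num) (by norm_num) (by linarith)
  · refine ⟨1, one_pos, fun n => ?_⟩
    refine le_trans (Real.rpow_le_rpow_of_exponent_le (by norm_num) ?_)
      (le_ncard_of_not_dvd hcard hk h2 h3 h5 n)
    have hk3 : 2 ≤ k / 3 := by
      rw [Nat.even_iff] at h2
      omega
    refine (hpow (k / 3) n hk3).trans ?_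
    have : (0 : ℝ) ≤ ((k / 3 : ℕ) : ℝ) ^ n := by positivity
    linarith

end Main

theorem theorem3 {S : Type*} [Finite S] (k : ℕ) (hcard : Nat.card S = k) (hk : 3 < k) :
    (Even k → ∀ n : ℕ, 2 ^ ((k / 2) ^ n) ≤ (nQuasigroups n S).ncard) ∧
    (3 ∣ k → ∀ n : ℕ, 2 ^ (n * (k / 3) ^ n) ≤ (nQuasigroups n S).ncard) ∧
    (k = 5 → ∃ c : ZMod 3 → ℝ, (∀ r : ZMod 3, c r < 0.072) ∧
      ∀ n : ℕ, (2 : ℝ) ^ ((3 : ℝ) ^ ((n : ℝ) / 3 - c (n : ZMod 3))) ≤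
        ((nQuasigroups n S).ncard : ℝ)) ∧
    (¬ Even k → ¬ 3 ∣ k → k ≠ 5 → ∀ n : ℕ,
      (2 : ℝ) ^ ((1.5 : ℝ) * (((k / 3 : ℕ) : ℝ) ^ n)) ≤ ((nQuasigroups n S).ncard : ℝ)) ∧
    (∃ c : ℝ, 0 < c ∧ ∀ n : ℕ,
      (2 : ℝ) ^ ((2 : ℝ) ^ (c * (n : ℝ))) ≤ ((nQuasigroups n S).ncard : ℝ)) := by
  refine ⟨two_pow_le_ncard_of_even hcard hk, two_pow_le_ncard_of_three_dvd hcard hk, ?_,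
    le_ncard_of_not_dvd hcard hk, exists_doubly_exponential_le hcard hk⟩
  rintro rfl
  exact ⟨fun _ => 14 / 195, fun _ => by norm_num, le_ncard_of_card_eq_five hcard⟩
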